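/- Let $g \in L^2(\mathbb{R})$ be complex-valued, let $a, b > 0$ be real numbers with $ab \le 1$, and let $\hat g \in L^2(\mathbb{R})$ be the Fourier transform of $g$, i.e. the image of $g$ under the unitary extension to $L^2(\mathbb{R})$ of $\hat f(\xi) = \int_{\mathbb{R}} f(x) e^{-2\pi i x \xi}\,dx$. Then the following two conditions are equivalent. (1) For every integer $k \neq 0$, $$\sum_{n \in \mathbb{Z}} g(x-na)\,\overline{g(x-na-k/b)} = 0 \quad \text{for a.e. } x \in \mathbb{R},$$ and $$\sum_{n \in \mathbb{Z}} |g(x-na)|^2 = b \quad \text{for a.e. } x \in \mathbb{R}.$$ (2) For every integer $k \neq 0$, $$\sum_{n \in \mathbb{Z}} \hat g(x-nb)\,\overline{\hat g(x-nb-k/a)} = 0 \quad \text{for a.e. } x \in \mathbb{R},$$ and $$\sum_{n \in \mathbb{Z}} |\hat g(x-nb)|^2 = a \quad \text{for a.e. } x \in \mathbb{R}.$$ All series are understood to converge absolutely for a.e. $x$. -/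

import Mathlib

open MeasureTheory ComplexConjugate FourierTransform

/-! Both conditions describe the ambiguity function `A_g(s,t) = ∫ e(tx) g(x) conj(g(x-s)) dx` on a
lattice. For fixed `k` the series in (1) is the `a`-periodization of the integrable function `g ·
conj(g(· - k/b))`. It is a.e. a constant `c` iff its Fourier coefficients are those of `c`, so (1)
says that `A_g(k/b, m/a)` is `ab` at the origin and `0` elsewhere
(`tight_conditions_iff_ambiguity`). Since `A_g(s,t) = e(st) A_ĝ(-t,s)` (`ambiguity_eq_fourier`), the
Fourier transform turns this lattice into that of (2), and a unimodular phase does not affect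
vanishing. -/

/-- An integrable function on `(0, 1]` all of whose Fourier coefficients vanish is zero a.e. -/
theorem ae_eq_zero_of_forall_integral_fourierChar_mul_eq_zero {P : ℝ → ℂ}
    (hP : IntegrableOn P (Set.Ioc 0 1))
    (h : ∀ m : ℤ, ∫ x in Set.Ioc (0 : ℝ) 1, ((𝐞 (m * x) : Circle) : ℂ) * P x = 0) :
    ∀ᵐ x : ℝ, x ∈ Set.Ioc (0 : ℝ) 1 → P x = 0 := by
  have hint : ∀ ψ : C(AddCircle (1 : ℝ), ℂ),
      IntegrableOn (fun x : ℝ => ψ (x : AddCircle (1 : ℝ)) * P x) (Set.Ioc 0 1) := fun ψ =>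
    hP.bdd_mul (c := ‖ψ‖)
      (ψ.continuous.comp (AddCircle.continuous_mk' 1)).aestronglyMeasurable
      (.of_forall fun x => ψ.norm_coe_le_norm _)
  -- Pairing with `P` is a bounded functional that kills the characters, hence their dense span.
  let Λ : C(AddCircle (1 : ℝ), ℂ) →ₗ[ℂ] ℂ :=
    { toFun := fun ψ => ∫ x in Set.Ioc (0 : ℝ) 1, ψ (x : AddCircle (1 : ℝ)) * P x
      map_add' := fun ψ₁ ψ₂ => by
        simp only [ContinuousMap.add_apply, add_mul]
        exact integral_add (hint ψ₁) (hint ψ₂)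
      map_smul' := fun c ψ => by
        simp only [ContinuousMap.smul_apply, smul_eq_mul, mul_assoc, RingHom.id_apply]
        exact integral_const_mul _ _ }
  have hΛcont : Continuous Λ := by
    refine (Λ.mkContinuous (∫ x in Set.Ioc (0 : ℝ) 1, ‖P x‖) fun ψ => ?_).continuous
    refine (norm_integral_le_integral_norm _).trans ?_
    rw [← integral_mul_const]
    refine integral_mono (hint ψ).norm (hP.norm.mul_const _) fun x => ?_
    simp only [norm_mul]
    rw [mul_comm]
    gcongr
    exact ψ.norm_coe_le_norm _
  have hΛ : ∀ ψ, Λ ψ = 0 := by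
    intro ψ
    have hψ : ψ ∈ (Submodule.span ℂ (Set.range <| @fourier 1)).topologicalClosure := by
      rw [span_fourier_closure_eq_top]; trivial
    have hle : (Submodule.span ℂ (Set.range <| @fourier 1)).topologicalClosure ≤
        LinearMap.ker Λ := by
      refine Submodule.topologicalClosure_minimal _ ?_ ?_
      · rw [Submodule.span_le]
        rintro _ ⟨m, rfl⟩
        change ∫ x in Set.Ioc (0 : ℝ) 1, fourier m (x : AddCircle (1 : ℝ)) * P x = 0
        rw [← h m]
        congr 1 with x
        rw [fourier_coe_apply, Real.fourierChar_apply]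
        push_cast
        ring_nf
      · exact isClosed_singleton.preimage hΛcont
    exact hle hψ
  have hIoo : ∀ᵐ x : ℝ, x ∈ Set.Ioo (0 : ℝ) 1 → P x = 0 := by
    refine isOpen_Ioo.ae_eq_zero_of_integral_contDiff_smul_eq_zero
      (hP.mono_set Set.Ioo_subset_Ioc_self).locallyIntegrableOn fun φ hφ _ hsupp => ?_
    have hz : ∀ x ∉ Set.Ioo (0 : ℝ) 1, φ x = 0 := fun x hx =>
      image_eq_zero_of_notMem_tsupport fun h' => hx (hsupp h')
    -- A test function supported in the open interval vanishes at both ends, so it descends to the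
    -- circle.
    let ψ : C(AddCircle (1 : ℝ), ℂ) :=
      ⟨AddCircle.liftIoc 1 0 fun x => (φ x : ℂ), AddCircle.liftIoc_zero_continuous
        (by rw [hz 0 (by simp), hz 1 (by simp)])
        (Complex.continuous_ofReal.comp hφ.continuous).continuousOn⟩
    rw [← hΛ ψ, ← setIntegral_eq_integral_of_forall_compl_eq_zero (s := Set.Ioc (0 : ℝ) 1)]
    · refine setIntegral_congr_fun measurableSet_Ioc fun x hx => ?_
      change φ x • P x = AddCircle.liftIoc 1 0 (fun x => (φ x : ℂ)) (x : AddCircle (1 : ℝ)) * P x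
      rw [AddCircle.liftIoc_zero_coe_apply hx, Complex.real_smul]
    · intro x hx
      rw [hz x fun h' => hx (Set.Ioo_subset_Ioc_self h'), zero_smul]
  have hne : ∀ᵐ x : ℝ, x ≠ 1 := by simp [ae_iff]
  filter_upwards [hIoo, hne] with x hx hx1 hmem
  exact hx ⟨hmem.1, lt_of_le_of_ne hmem.2 hx1⟩

theorem ae_of_ae_mem_Ioc {p : ℝ → Prop} (hp : ∀ x (n : ℤ), p (x + n) → p x)
    (h : ∀ᵐ x : ℝ, x ∈ Set.Ioc (0 : ℝ) 1 → p x) : ∀ᵐ x : ℝ, p x := by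
  have h' : ∀ᵐ x : ℝ, ∀ n : ℤ, x + n ∈ Set.Ioc (0 : ℝ) 1 → p (x + n) :=
    ae_all_iff.2 fun n =>
      (measurePreserving_add_right volume (n : ℝ)).quasiMeasurePreserving.ae h
  filter_upwards [h'] with x hx
  obtain ⟨n, hn, -⟩ := existsUnique_add_zsmul_mem_Ioc (one_pos (α := ℝ)) x 0
  have hn' : x + n ∈ Set.Ioc (0 : ℝ) 1 := by simpa using hn
  exact hp x n (hx n hn')

/-! ### Periodization and its Fourier coefficients -/

section Periodization

variable {h : ℝ → ℂ}

theorem summable_integral_norm_comp_add_int (hh : Integrable h) :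
    Summable fun n : ℤ => ∫ x in Set.Ioc (0 : ℝ) 1, ‖h (x + n)‖ := by
  simpa only [intervalIntegral.integral_of_le zero_le_one] using
    hh.norm.hasSum_intervalIntegral_comp_add_int.summable

theorem tsum_eLpNorm_comp_add_int_ne_top (hh : Integrable h) :
    ∑' n : ℤ, eLpNorm (fun x => h (x + n)) 1 (volume.restrict (Set.Ioc 0 1)) ≠ ⊤ := by
  have hi : ∀ n : ℤ, IntegrableOn (fun x : ℝ => h (x + n)) (Set.Ioc 0 1) := fun n =>
    (hh.comp_add_right _).integrableOn
  simp_rw [eLpNorm_one_eq_lintegral_enorm, ← ofReal_integral_norm_eq_lintegral_enorm (hi _)]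
  exact (summable_integral_norm_comp_add_int hh).tsum_ofReal_ne_top

theorem ae_summable_norm_comp_add_int (hh : Integrable h) :
    ∀ᵐ x ∂(volume.restrict (Set.Ioc (0 : ℝ) 1)), Summable fun n : ℤ => ‖h (x + n)‖ :=
  summable_norm_of_tsum_eLpNorm_ne_top le_rfl
    (fun n => ((hh.comp_add_right (n : ℝ)).integrableOn (s := Set.Ioc 0 1)).aestronglyMeasurable)
    (tsum_eLpNorm_comp_add_int_ne_top hh)

theorem integrableOn_tsum_comp_add_int (hh : Integrable h) :
    IntegrableOn (fun x => ∑' n : ℤ, h (x + n)) (Set.Ioc 0 1) := by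
  have hi : ∀ n : ℤ, IntegrableOn (fun x : ℝ => h (x + n)) (Set.Ioc 0 1) := fun n =>
    (hh.comp_add_right _).integrableOn
  have hlt : ∫⁻ x in Set.Ioc (0 : ℝ) 1, ∑' n : ℤ, ‖h (x + n)‖ₑ < ⊤ := by
    rw [lintegral_tsum fun n => (hi n).aestronglyMeasurable.enorm]
    simpa only [eLpNorm_one_eq_lintegral_enorm] using
      (tsum_eLpNorm_comp_add_int_ne_top hh).lt_top
  refine ⟨?_, ?_⟩
  · have hsum := ae_summable_norm_comp_add_int hh
    refine aestronglyMeasurable_of_tendsto_ae Filter.atTop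
      (f := fun (s : Finset ℤ) (x : ℝ) => ∑ n ∈ s, h (x + n))
      (fun s => Finset.aestronglyMeasurable_fun_sum s fun n _ => (hi n).aestronglyMeasurable) ?_
    filter_upwards [hsum] with x hx
    exact hx.of_norm.hasSum
  · refine lt_of_le_of_lt (lintegral_mono_ae ?_) hlt
    filter_upwards with x
    exact enorm_tsum_le_tsum_enorm

/-- Unfolding: the character is 1-periodic, so it factors out of the sum over translates. -/
theorem integral_fourierChar_mul_eq_setIntegral_tsum (hh : Integrable h) (m : ℤ) :
    ∫ x, ((𝐞 (m * x) : Circle) : ℂ) * h x =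
      ∫ x in Set.Ioc (0 : ℝ) 1, ((𝐞 (m * x) : Circle) : ℂ) * ∑' n : ℤ, h (x + n) := by
  have hcont : Continuous fun x : ℝ => ((𝐞 (m * x) : Circle) : ℂ) := by fun_prop
  have hF : Integrable fun x : ℝ => ((𝐞 (m * x) : Circle) : ℂ) * h x :=
    hh.bdd_mul (c := 1) hcont.aestronglyMeasurable (.of_forall fun x => (Circle.norm_coe _).le)
  have hper : ∀ (x : ℝ) (n : ℤ), 𝐞 (m * (x + n)) = 𝐞 (m * x) := by
    intro x n
    rw [mul_add, AddChar.map_add_eq_mul]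
    have : (𝐞 ((m : ℝ) * n) : Circle) = 1 := by
      ext
      rw [Real.fourierChar_apply, Circle.coe_one, Complex.exp_eq_one_iff]
      exact ⟨m * n, by push_cast; ring⟩
    rw [this, mul_one]
  have h1 := hF.hasSum_intervalIntegral_comp_add_int
  simp only [intervalIntegral.integral_of_le zero_le_one] at h1
  have h2 := hasSum_integral_of_summable_integral_norm
    (μ := volume.restrict (Set.Ioc (0 : ℝ) 1))
    (F := fun (n : ℤ) (x : ℝ) => ((𝐞 (m * (x + n)) : Circle) : ℂ) * h (x + n))
    (fun n => (hF.comp_add_right _).integrableOn) (by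
      simpa using summable_integral_norm_comp_add_int hF)
  rw [h1.unique h2]
  simp only [hper, tsum_mul_left]

theorem integral_Ioc_fourierChar_int_mul (m : ℤ) :
    ∫ x in Set.Ioc (0 : ℝ) 1, ((𝐞 (m * x) : Circle) : ℂ) = if m = 0 then 1 else 0 := by
  split_ifs with hm
  · simp [hm]
  · have hc : (2 * Real.pi * Complex.I * m : ℂ) ≠ 0 := by
      simp [Complex.I_ne_zero, Real.pi_ne_zero, hm]
    have h1 : ∀ x : ℝ, ((𝐞 (m * x) : Circle) : ℂ) = Complex.exp ((2 * Real.pi * Complex.I * m) * x) := by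
      intro x
      rw [Real.fourierChar_apply]
      push_cast
      ring_nf
    have h2 : Complex.exp (2 * Real.pi * Complex.I * m) = 1 :=
      Complex.exp_eq_one_iff.2 ⟨m, by ring⟩
    simp_rw [h1]
    rw [← intervalIntegral.integral_of_le zero_le_one, integral_exp_mul_complex hc]
    simp [h2]

theorem ae_hasSum_comp_add_int_iff (hh : Integrable h) (c : ℂ) :
    (∀ᵐ x : ℝ, HasSum (fun n : ℤ => h (x + n)) c) ↔
      ∀ m : ℤ, ∫ x, ((𝐞 (m * x) : Circle) : ℂ) * h x = if m = 0 then c else 0 := by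
  have hP := integrableOn_tsum_comp_add_int hh
  constructor
  · intro H m
    have : ∫ x in Set.Ioc (0 : ℝ) 1, ((𝐞 (m * x) : Circle) : ℂ) * ∑' n : ℤ, h (x + n) =
        ∫ x in Set.Ioc (0 : ℝ) 1, ((𝐞 (m * x) : Circle) : ℂ) * c := by
      refine integral_congr_ae (ae_restrict_of_ae ?_)
      filter_upwards [H] with x hx
      rw [hx.tsum_eq]
    rw [integral_fourierChar_mul_eq_setIntegral_tsum hh, this, integral_mul_const,
      integral_Ioc_fourierChar_int_mul]
    split_ifs <;> simp
  · intro H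
    have hc : IntegrableOn (fun _ : ℝ => c) (Set.Ioc 0 1) := by simp
    have hz := ae_eq_zero_of_forall_integral_fourierChar_mul_eq_zero (hP.sub hc) fun m => by
      have hcont : Continuous fun x : ℝ => ((𝐞 (m * x) : Circle) : ℂ) := by fun_prop
      have hbdd : ∀ {f : ℝ → ℂ}, IntegrableOn f (Set.Ioc 0 1) →
          IntegrableOn (fun x : ℝ => ((𝐞 (m * x) : Circle) : ℂ) * f x) (Set.Ioc 0 1) := fun hf =>
        Integrable.bdd_mul (c := 1) hf hcont.aestronglyMeasurable (.of_forall fun x => (Circle.norm_coe _).le)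
      simp only [Pi.sub_apply, mul_sub]
      rw [integral_sub (hbdd hP) (hbdd hc), ← integral_fourierChar_mul_eq_setIntegral_tsum hh,
        H m, integral_mul_const, integral_Ioc_fourierChar_int_mul]
      split_ifs <;> simp
    refine ae_of_ae_mem_Ioc (fun x n hx => ?_) ?_
    · rw [← (Equiv.addLeft n).hasSum_iff]
      simpa [Function.comp_def, add_assoc] using hx
    · filter_upwards [hz, (ae_restrict_iff' measurableSet_Ioc).1 (ae_summable_norm_comp_add_int hh)]
        with x hx hs hmem
      have := (hs hmem).of_norm.hasSum
      have heq : ∑' n : ℤ, h (x + n) = c := sub_eq_zero.1 (hx hmem)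
      rwa [heq] at this

theorem ae_hasSum_comp_sub_int_mul_iff (hh : Integrable h) {a : ℝ} (ha : 0 < a) (c : ℂ) :
    (∀ᵐ x : ℝ, HasSum (fun n : ℤ => h (x - n * a)) c) ↔
      ∀ m : ℤ, ∫ x, ((𝐞 (m / a * x) : Circle) : ℂ) * h x = if m = 0 then a * c else 0 := by
  have hscale : (∀ᵐ x : ℝ, HasSum (fun n : ℤ => h (x - n * a)) c) ↔
      ∀ᵐ x : ℝ, HasSum (fun n : ℤ => h (a * (x + n))) c := by
    have key : ∀ x : ℝ, HasSum (fun n : ℤ => h (a * (x + n))) c ↔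
        HasSum (fun n : ℤ => h (a * x - n * a)) c := fun x => by
      -- The reflection `n ↦ -n` reconciles `x - na` with `a(x + n)`.
      rw [← (Equiv.neg ℤ).hasSum_iff]
      refine iff_of_eq (congrArg (HasSum · c) (funext fun n => ?_))
      simp only [Function.comp_apply, Equiv.neg_apply, Int.cast_neg]
      ring_nf
    simp_rw [key]
    refine ⟨fun H => ?_, fun H => ?_⟩
    · exact (Measure.quasiMeasurePreserving_smul volume ha.ne').ae H
    · have := (Measure.quasiMeasurePreserving_smul volume (inv_pos.2 ha).ne').ae H
      filter_upwards [this] with x hx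
      simpa [ha.ne'] using hx
  rw [hscale, ae_hasSum_comp_add_int_iff (h := fun x => h (a * x)) (hh.comp_mul_left' ha.ne')]
  refine forall_congr' fun m => ?_
  have : ∫ x : ℝ, ((𝐞 (m * x) : Circle) : ℂ) * h (a * x) = (a⁻¹ : ℝ) * ∫ x, ((𝐞 (m / a * x) : Circle) : ℂ) * h x := by
    have := Measure.integral_comp_mul_left (fun x => ((𝐞 (m / a * x) : Circle) : ℂ) * h x) a
    rw [abs_of_pos (inv_pos.2 ha), Complex.real_smul] at this
    rw [← this]
    congr 1 with x
    rw [show (m : ℝ) / a * (a * x) = m * x by field_simp]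
  have ha' : (a : ℂ) ≠ 0 := Complex.ofReal_ne_zero.2 ha.ne'
  rw [this, Complex.ofReal_inv, inv_mul_eq_iff_eq_mul₀ ha']
  split_ifs <;> simp

end Periodization

/-! ### The ambiguity function and its Fourier covariance -/

/-- The ambiguity function `∫ e(tx) g(x) conj(g(x - s)) dx` of `g`. -/
noncomputable def ambiguity (g : ℝ → ℂ) (s t : ℝ) : ℂ :=
  ∫ x, ((𝐞 (t * x) : Circle) : ℂ) * (g x * conj (g (x - s)))

theorem ambiguity_congr_ae {f g : ℝ → ℂ} (h : f =ᵐ[volume] g) (s t : ℝ) :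
    ambiguity f s t = ambiguity g s t := by
  refine integral_congr_ae ?_
  filter_upwards [h, (measurePreserving_sub_right volume s).quasiMeasurePreserving.ae h]
    with x h1 h2
  rw [h1, h2]

/-- The value is the inner product of a translated and modulated `g` with `g`. The modulation has
frequency `-t` because `inner` conjugates its first argument. -/
theorem continuous_ambiguity (s t : ℝ) :
    Continuous fun g : Lp ℂ 2 (volume : Measure ℝ) => ambiguity g s t := by
  have he : MemLp (fun x : ℝ => ((𝐞 (-(t * x)) : Circle) : ℂ)) ⊤ volume :=
    memLp_top_of_bound (by fun_prop) 1 (.of_forall fun x => (Circle.norm_coe _).le)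
  let T := Lp.compMeasurePreservingₗᵢ (E := ℂ) (p := 2) ℂ _
    (measurePreserving_sub_right (volume : Measure ℝ) s)
  let M := (ContinuousLinearMap.mul ℂ ℂ).holderL (volume : Measure ℝ) ⊤ 2 2 he.toLp
  have hc : Continuous fun g : Lp ℂ 2 (volume : Measure ℝ) => inner ℂ (M (T g)) g :=
    (M.continuous.comp T.continuous).inner continuous_id
  convert hc using 2 with g
  rw [L2.inner_def]
  refine integral_congr_ae ?_
  filter_upwards [Lp.coeFn_compMeasurePreserving g (measurePreserving_sub_right volume s),
    (ContinuousLinearMap.mul ℂ ℂ).coeFn_holder (r := 2) he.toLp (T g), he.coeFn_toLp]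
    with x h1 h2 h3
  have h4 : (M (T g)) x = ((𝐞 (-(t * x)) : Circle) : ℂ) * g (x - s) := by
    refine h2.trans ?_
    rw [h3]
    exact congrArg _ h1
  rw [h4, RCLike.inner_apply, map_mul (starRingEnd ℂ), AddChar.map_neg_eq_inv, Circle.coe_inv_eq_conj,
    Complex.conj_conj]
  ring

-- Fourier inversion computes `𝓕 K` for the second factor `K`, and `∫ 𝓕 f · K = ∫ f · 𝓕 K` moves the
-- transform across.
open SchwartzMap in
theorem SchwartzMap.ambiguity_eq_fourier (f : 𝓢(ℝ, ℂ)) (s t : ℝ) :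
    ambiguity f s t = ((𝐞 (s * t) : Circle) : ℂ) * ambiguity (𝓕 f : 𝓢(ℝ, ℂ)) (-t) s := by
  set φ : 𝓢(ℝ, ℂ) := 𝓕 f with hφ
  let K : ℝ → ℂ := fun ξ => ((𝐞 (s * ξ) : Circle) : ℂ) * conj (φ (ξ + t))
  have hK : Integrable K :=
    Integrable.bdd_mul (c := 1)
      (Complex.conjCLE.toContinuousLinearMap.integrable_comp (φ.integrable.comp_add_right t))
      (by fun_prop) (.of_forall fun x => (Circle.norm_coe _).le)
  have hFK : ∀ x, 𝓕 K x = ((𝐞 ((x - s) * t) : Circle) : ℂ) * conj (f (x - s)) := by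
    intro x
    have hinv : f (x - s) = ∫ ξ, ((𝐞 (ξ * (x - s)) : Circle) : ℂ) * φ ξ := by
      have h1 : 𝓕⁻ φ = f := FourierPair.fourierInv_fourier_eq f
      conv_lhs => rw [← h1]
      rw [SchwartzMap.fourierInv_coe, Real.fourierInv_eq]
      simp only [Circle.smul_def, smul_eq_mul]
      refine integral_congr_ae (.of_forall fun ξ => ?_)
      simp [mul_comm]
    rw [hinv, ← integral_add_right_eq_self _ t, ← integral_conj, ← integral_const_mul,
      Real.fourier_real_eq]
    congr 1 with ξ
    have hphase : 𝐞 (-(ξ * x)) * 𝐞 (s * ξ) =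
        𝐞 ((x - s) * t) * 𝐞 (-((ξ + t) * (x - s))) := by
      rw [← AddChar.map_add_eq_mul, ← AddChar.map_add_eq_mul]
      ring_nf
    simp only [K, Circle.smul_def, smul_eq_mul, map_mul (starRingEnd ℂ),
      ← Circle.coe_inv_eq_conj, ← AddChar.map_neg_eq_inv, ← mul_assoc]
    rw [← Circle.coe_mul, hphase, Circle.coe_mul]
  have hself : ∫ ξ, φ ξ * K ξ = ∫ x, f x * 𝓕 K x := by
    simpa using! VectorFourier.integral_fourierIntegral_smul_eq_flip (L := innerₗ ℝ)
      Real.continuous_fourierChar continuous_inner f.integrable hK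
  have hR : ambiguity φ (-t) s = ∫ ξ, φ ξ * K ξ := by
    refine integral_congr_ae (.of_forall fun ξ => ?_)
    simp only [K, sub_neg_eq_add]
    ring
  rw [hR, hself, ← integral_const_mul]
  refine integral_congr_ae (.of_forall fun x => ?_)
  simp only [hFK]
  rw [show t * x = s * t + (x - s) * t by ring, AddChar.map_add_eq_mul, Circle.coe_mul]
  ring

/-- Both sides are continuous in `g`, and Schwartz functions are dense in `L²`. -/
theorem ambiguity_eq_fourier (g : Lp ℂ 2 (volume : Measure ℝ)) (s t : ℝ) :
    ambiguity g s t = ((𝐞 (s * t) : Circle) : ℂ) * ambiguity (𝓕 g : Lp ℂ 2 (volume : Measure ℝ)) (-t) s := by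
  refine DenseRange.induction_on
    (p := fun g : Lp ℂ 2 (volume : Measure ℝ) => ambiguity g s t =
      ((𝐞 (s * t) : Circle) : ℂ) * ambiguity (𝓕 g : Lp ℂ 2 (volume : Measure ℝ)) (-t) s)
    (SchwartzMap.denseRange_toLpCLM (F := ℂ) (E := ℝ) (μ := volume) (p := 2)
      ENNReal.ofNat_ne_top) g
    (isClosed_eq (continuous_ambiguity s t) (continuous_const.mul
      ((continuous_ambiguity (-t) s).comp (Lp.fourierTransformₗᵢ ℝ ℂ).continuous))) fun f => ?_
  rw [SchwartzMap.toLpCLM_apply, SchwartzMap.toLp_fourier_eq,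
    ambiguity_congr_ae (f.coeFn_toLp 2) s t, ambiguity_congr_ae ((𝓕 f).coeFn_toLp 2) (-t) s]
  exact f.ambiguity_eq_fourier s t

theorem integrable_mul_conj_comp_sub {g : ℝ → ℂ} (hg : MemLp g 2) (s : ℝ) :
    Integrable fun x => g x * conj (g (x - s)) :=
  hg.integrable_mul (hg.comp_measurePreserving (measurePreserving_sub_right volume s)).star

/-- The period contributes a factor `a`, so the value at the origin is symmetric in `a` and `b`. -/
theorem tight_conditions_iff_ambiguity {g : ℝ → ℂ} (hg : MemLp g 2) {a : ℝ} (ha : 0 < a)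
    (b : ℝ) :
    ((∀ k : ℤ, k ≠ 0 → ∀ᵐ x : ℝ,
        HasSum (fun n : ℤ => g (x - n * a) * conj (g (x - n * a - k / b))) 0) ∧
      (∀ᵐ x : ℝ, HasSum (fun n : ℤ => ‖g (x - n * a)‖ ^ 2) b)) ↔
    ∀ k m : ℤ, ambiguity g (k / b) (m / a) = if k = 0 ∧ m = 0 then (a : ℂ) * b else 0 := by
  have hk : ∀ (k : ℤ) (c : ℂ), (∀ᵐ x : ℝ,
      HasSum (fun n : ℤ => g (x - n * a) * conj (g (x - n * a - k / b))) c) ↔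
      ∀ m : ℤ, ambiguity g (k / b) (m / a) = if m = 0 then a * c else 0 := fun k c =>
    ae_hasSum_comp_sub_int_mul_iff (integrable_mul_conj_comp_sub hg (k / b)) ha c
  have h0 : (∀ᵐ x : ℝ, HasSum (fun n : ℤ => ‖g (x - n * a)‖ ^ 2) b) ↔ ∀ᵐ x : ℝ,
      HasSum (fun n : ℤ => g (x - n * a) * conj (g (x - n * a - (0 : ℤ) / b))) (b : ℂ) := by
    refine Filter.eventually_congr (.of_forall fun x => ?_)
    rw [← Complex.hasSum_ofReal]
    simp [Complex.mul_conj']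
  rw [h0, hk 0 b]
  simp only [hk]
  constructor
  · rintro ⟨h1, h2⟩ k m
    by_cases hk0 : k = 0
    · subst hk0
      simpa using h2 m
    · simpa [hk0] using h1 k hk0 m
  · intro H
    refine ⟨fun k hk0 m => ?_, fun m => ?_⟩
    · simpa [hk0] using H k m
    · simpa using H 0 m

theorem corollary2p4 (g : Lp ℂ 2 (volume : Measure ℝ)) (a b : ℝ) (ha : 0 < a) (hb : 0 < b)
    (hab : a * b ≤ 1) :
    ((∀ k : ℤ, k ≠ 0 → ∀ᵐ x : ℝ,
        HasSum (fun n : ℤ => g (x - n * a) * conj (g (x - n * a - k / b))) 0) ∧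
      (∀ᵐ x : ℝ, HasSum (fun n : ℤ => ‖g (x - n * a)‖ ^ 2) b)) ↔
    ((∀ k : ℤ, k ≠ 0 → ∀ᵐ x : ℝ,
        HasSum (fun n : ℤ => (𝓕 g) (x - n * b) * conj ((𝓕 g) (x - n * b - k / a))) 0) ∧
      (∀ᵐ x : ℝ, HasSum (fun n : ℤ => ‖(𝓕 g) (x - n * b)‖ ^ 2) a)) := by
  rw [tight_conditions_iff_ambiguity (Lp.memLp g) ha b,
    tight_conditions_iff_ambiguity (Lp.memLp (𝓕 g)) hb a]
  have key : ∀ k m : ℤ, (ambiguity g (k / b) (m / a) =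
      if k = 0 ∧ m = 0 then (a : ℂ) * b else 0) ↔
      ambiguity (𝓕 g : Lp ℂ 2 (volume : Measure ℝ)) ((-m : ℤ) / a) (k / b) =
        if -m = 0 ∧ k = 0 then (b : ℂ) * a else 0 := by
    intro k m
    rw [ambiguity_eq_fourier, Int.cast_neg, neg_div]
    by_cases hkm : k = 0 ∧ m = 0
    · obtain ⟨rfl, rfl⟩ := hkm
      simp [mul_comm]
    · rw [if_neg hkm, if_neg (by simpa [and_comm] using hkm), mul_eq_zero]
      exact or_iff_right (Circle.coe_ne_zero _)
  simp only [key]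
  -- The map `(k, m) ↦ (-m, k)` is a bijection of the index lattice.
  exact ⟨fun H m k => by simpa using H k (-m), fun H k m => H (-m) k⟩
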